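/- Let $p_0=(0,0)$, $p_1=(1,0)$, $p_2=(\tfrac12,\tfrac{\sqrt3}{2})$, $f_i(x)=(x+p_i)/2$ for $x\in\mathbb R^2$, and let $K$ (the Sierpiński gasket) be the unique nonempty compact set with $K=f_0(K)\cup f_1(K)\cup f_2(K)$. For a finite word $w=w_1\ldots w_n$ in the letters $0,1,2$ write $|w|=n$, $K_w=f_{w_1}\circ\cdots\circ f_{w_n}(K)$ and, if $n\ge1$, $w^-=w_1\ldots w_{n-1}$ and $p_w=f_{w_1}\circ\cdots\circ f_{w_{n-1}}(p_{w_n})$. The Sierpiński graph $X$ has all finite words (including the empty one) as vertices; its edges are the vertical edges joining $w$ and $w^-$ ($|w|\ge1$), and the horizontal edges joining $w\neq w'$ with $|w|=|w'|\ge1$ and $K_w\cap K_{w'}\neq\emptyset$. Fix $\lambda\in(0,1)$, $C_1,C_2>0$ and $c\in(0,\lambda)$. Define symmetric conductances by $c(w^-,w)=c(w,w^-)=(3\lambda)^{-|w^-|}$ on vertical edges, and on horizontal edges of level $n$ by $c(x,y)=C_1(3\lambda)^{-n}$ if $p_x\ne p_y$ and $c(x,y)=C_2(3\lambda)^{-n}$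 if $p_x=p_y$; put $c(x,y)=0$ if $x,y$ are not joined by an edge. Let $$\pi(x)=\sum_{y\in X} c(x,y),\qquad P(x,y)=\frac{c(x,y)}{\pi(x)},\qquad m(x)=\Big(\frac{c}{3\lambda}\Big)^{|x|},\qquad \alpha(x)=\frac{\pi(x)}{m(x)}.$$ For $x\in X$ let, under $\mathbb P_x$, $(Y_n)_{n\ge0}$ be a Markov chain on $X$ with transition probability $P$ and $Y_0=x$, and let $(S_n)_{n\ge1}$ be independent exponential random variables with parameter $1$, the sequence $(S_n)$ being independent of $(Y_n)$. Put $T_n=S_n/\alpha(Y_{n-1})$ for $n\ge1$, $J_0=0$, $J_n=T_1+\cdots+T_n$, $\zeta=\sum_{n\ge1}T_n=\lim_{n\to\infty}J_n\in[0,\infty]$, and for $t\ge0$ let $X_t=Y_n$ if $J_n\le t<J_{n+1}$ for some $n\ge0$, and let $X_t$ be a cemetery point $\partial$ otherwise (the variable-speed continuous-time random walk). Then $\{X_t\}$ goes to infinity in finite time almost surely, that is, $$\mathbb P_x\Big[\lim_{t\uparrow\zeta}|X_t|=+\infty,\ \zeta<+\infty\Big]=1\qquad\text{for all }x\in X.$$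 -/

import Mathlib

open MeasureTheory ProbabilityTheory Filter Topology
open scoped NNReal ENNReal

noncomputable section

namespace SierpinskiWalk

/-! ### The Sierpinski gasket -/

/-- The Euclidean plane. -/
abbrev Plane : Type := EuclideanSpace ℝ (Fin 2)

/-- The corners `p₀ = (0,0)`, `p₁ = (1,0)`, `p₂ = (1/2, √3/2)`. -/
def corner : Fin 3 → Plane :=
  ![!₂[0, 0], !₂[1, 0], !₂[1 / 2, Real.sqrt 3 / 2]]

/-- The contractions `f_i(x) = (x + p_i)/2`. -/
def contr (i : Fin 3) (x : Plane) : Plane := (1 / 2 : ℝ) • (x + corner i)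

/-- `K` is a nonempty compact set with `K = f₀(K) ∪ f₁(K) ∪ f₂(K)`. -/
def IsGasket (K : Set Plane) : Prop :=
  K.Nonempty ∧ IsCompact K ∧ K = ⋃ i, contr i '' K

lemma dist_contr (i : Fin 3) (x y : Plane) : dist (contr i x) (contr i y) = dist x y / 2 := by
  rw [contr, contr, dist_smul₀, dist_add_right]
  norm_num
  ring

lemma continuous_contr (i : Fin 3) : Continuous (contr i) := by
  unfold contr
  fun_prop

lemma contr_corner (i : Fin 3) : contr i (corner i) = corner i := by
  rw [contr, ← two_smul ℝ (corner i), smul_smul]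
  norm_num

/-- The finite approximations `V₁ ⊆ V₂ ⊆ …` (indexed from `0`). -/
def approx : ℕ → Set Plane
  | 0 => Set.range corner
  | n + 1 => ⋃ i, contr i '' approx n

lemma isGasket_closure : IsGasket (closure (⋃ n, approx n)) := by
  obtain ⟨R, hR⟩ : ∃ R : ℝ, ∀ i, ‖corner i‖ ≤ R :=
    ⟨∑ i, ‖corner i‖, fun i =>
      Finset.single_le_sum (f := fun i => ‖corner i‖) (fun _ _ => norm_nonneg _)
        (Finset.mem_univ i)⟩
  have hball : ∀ n, approx n ⊆ Metric.closedBall 0 R := by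
    intro n
    induction n with
    | zero =>
      rintro _ ⟨i, rfl⟩
      simpa using hR i
    | succ n ih =>
      intro y hy
      simp only [approx, Set.mem_iUnion] at hy
      obtain ⟨i, x, hx, rfl⟩ := hy
      have h1 : ‖x‖ ≤ R := by simpa using ih hx
      have h2 : ‖x + corner i‖ ≤ R + R := (norm_add_le _ _).trans (add_le_add h1 (hR i))
      rw [mem_closedBall_zero_iff, contr, norm_smul]
      norm_num
      linarith
  have hcpt : IsCompact (closure (⋃ n, approx n)) :=
    (isCompact_closedBall (0 : Plane) R).of_isClosed_subset isClosed_closure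
      (closure_minimal (Set.iUnion_subset hball) Metric.isClosed_closedBall)
  refine ⟨⟨corner 0, subset_closure (Set.mem_iUnion.2 ⟨0, 0, rfl⟩)⟩, hcpt, ?_⟩
  have hU : (⋃ n, approx n) = ⋃ i, contr i '' ⋃ n, approx n := by
    ext y
    simp only [Set.mem_iUnion, Set.mem_image]
    constructor
    · rintro ⟨n, hn⟩
      cases n with
      | zero =>
        obtain ⟨i, rfl⟩ := hn
        exact ⟨i, corner i, ⟨0, i, rfl⟩, contr_corner i⟩
      | succ n =>
        simp only [approx, Set.mem_iUnion] at hn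
        obtain ⟨i, x, hx, rfl⟩ := hn
        exact ⟨i, x, ⟨n, hx⟩, rfl⟩
    · rintro ⟨i, x, ⟨n, hx⟩, rfl⟩
      exact ⟨n + 1, Set.mem_iUnion.2 ⟨i, x, hx, rfl⟩⟩
  conv_lhs => rw [hU]
  rw [closure_iUnion_of_finite]
  exact Set.iUnion_congr fun i =>
    (image_closure_of_isCompact hcpt (continuous_contr i).continuousOn).symm

lemma IsGasket.subset {A B : Set Plane} (hA : IsGasket A) (hB : IsGasket B) : A ⊆ B := by
  obtain ⟨a, ha, hmax⟩ := hA.2.1.exists_isMaxOn hA.1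
    (Metric.continuous_infDist_pt B).continuousOn
  have h0 : Metric.infDist a B ≤ 0 := by
    have ha' := ha
    rw [hA.2.2] at ha'
    obtain ⟨i, a', ha', hi⟩ := Set.mem_iUnion.1 ha'
    obtain ⟨b, hb, hab⟩ := hB.2.1.exists_infDist_eq_dist hB.1 a'
    have hfb : contr i b ∈ B := by
      rw [hB.2.2]
      exact Set.mem_iUnion.2 ⟨i, b, hb, rfl⟩
    have h1 : Metric.infDist a B ≤ dist a' b / 2 := by
      rw [← dist_contr i, ← hi]
      exact Metric.infDist_le_dist_of_mem hfb
    have h2 : Metric.infDist a' B ≤ Metric.infDist a B := hmax ha'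
    linarith
  intro x hx
  have hx0 : Metric.infDist x B ≤ Metric.infDist a B := hmax hx
  exact (hB.2.1.isClosed.mem_iff_infDist_zero hB.1).2
    (le_antisymm (hx0.trans h0) Metric.infDist_nonneg)

theorem existsUnique_isGasket : ∃! K : Set Plane, IsGasket K :=
  ⟨_, isGasket_closure, fun _ h =>
    Set.Subset.antisymm (h.subset isGasket_closure) (isGasket_closure.subset h)⟩

/-- The Sierpinski gasket: the unique nonempty compact `K` with `K = f₀(K) ∪ f₁(K) ∪ f₂(K)`. -/
def gasket : Set Plane := existsUnique_isGasket.choose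

/-! ### The Sierpinski graph -/

/-- Finite words `w₁ … wₙ` in the letters `0, 1, 2`, first letter at the head of the list; the
empty word is the root `o`. -/
def Word : Type := List (Fin 3)

/-- The length `|w|` of a word. -/
def Word.len (w : Word) : ℕ := List.length w

/-- The father `w⁻ = w₁ … wₙ₋₁` of `w = w₁ … wₙ` (junk value: the empty word is its own father). -/
def Word.father (w : Word) : Word := List.dropLast w

/-- The words form a countable set with the discrete σ-algebra. -/
instance : MeasurableSpace Word := ⊤

instance : DiscreteMeasurableSpace Word := ⟨fun _ => trivial⟩

instance : Countable Word := inferInstanceAs (Countable (List (Fin 3)))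

/-- `f_w = f_{w₁} ∘ … ∘ f_{wₙ}`. -/
def wordMap (w : Word) : Plane → Plane :=
  List.foldr (fun i g => contr i ∘ g) id w

/-- The cell `K_w = f_w(K)`. -/
def cell (w : Word) : Set Plane := wordMap w '' gasket

/-- The vertex `p_w = f_{w₁ … wₙ₋₁}(p_{wₙ})`, which is `Φₙ(w)`, for `w` of length `n ≥ 1`
(junk value `0` for the empty word). -/
def vertexPoint (w : Word) : Plane :=
  match List.getLast? w with
  | none => 0
  | some i => wordMap w.father (corner i)

/-- Vertical edges: one of the two words is nonempty with the other as its father. -/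
def VertAdj (x y : Word) : Prop :=
  (1 ≤ x.len ∧ y = x.father) ∨ (1 ≤ y.len ∧ x = y.father)

/-- Horizontal edges: distinct words of the same length `n ≥ 1` whose cells intersect. -/
def HorAdj (x y : Word) : Prop :=
  x.len = y.len ∧ 1 ≤ x.len ∧ x ≠ y ∧ (cell x ∩ cell y).Nonempty

/-! ### Conductances, random walk, measure -/

open Classical in
/-- The conductances: `c(x,y) = 1/(3λ)ⁿ` between levels `n` and `n+1`; on level `n`,
`C₁/(3λ)ⁿ` for horizontal edges of type I (`Φₙ(x) ≠ Φₙ(y)`) and `C₂/(3λ)ⁿ` for those of type II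
(`Φₙ(x) = Φₙ(y)`); zero if `x` and `y` are not neighbours. -/
def conductance (lam C₁ C₂ : ℝ) (x y : Word) : ℝ :=
  if VertAdj x y then 1 / (3 * lam) ^ (min x.len y.len)
  else if HorAdj x y then
    if vertexPoint x = vertexPoint y then C₂ / (3 * lam) ^ x.len else C₁ / (3 * lam) ^ x.len
  else 0

/-- `π(x) = ∑_y c(x,y)` (a sum with finitely many nonzero terms). -/
def totalCond (lam C₁ C₂ : ℝ) (x : Word) : ℝ := ∑' y, conductance lam C₁ C₂ x y

/-- The transition probability `P(x,y) = c(x,y)/π(x)`. -/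
def transProb (lam C₁ C₂ : ℝ) (x y : Word) : ℝ :=
  conductance lam C₁ C₂ x y / totalCond lam C₁ C₂ x

/-- The measure `m(x) = (c/(3λ))^{|x|}`. -/
def weight (lam c : ℝ) (x : Word) : ℝ := (c / (3 * lam)) ^ x.len

/-- The jump rate `α(x) = π(x)/m(x)`. -/
def rate (lam C₁ C₂ c : ℝ) (x : Word) : ℝ := totalCond lam C₁ C₂ x / weight lam c x

/-! ### The variable speed continuous time random walk -/

variable {Ω : Type*}

open Classical in
/-- `Y` is a Markov chain with transition probability `P(x,y) = c(x,y)/π(x)` started at `x₀`. -/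
structure IsWalkFrom [MeasurableSpace Ω] (lam C₁ C₂ : ℝ) (x₀ : Word) (μ : Measure Ω)
    (Y : ℕ → Ω → Word) : Prop where
  measurable : ∀ n, Measurable (Y n)
  law : ∀ (n : ℕ) (w : ℕ → Word),
    μ {ω | ∀ i ≤ n, Y i ω = w i} =
      ENNReal.ofReal ((if w 0 = x₀ then 1 else 0) *
        ∏ i ∈ Finset.range n, transProb lam C₁ C₂ (w i) (w (i + 1)))

/-- `S` is a sequence of independent exponential random variables with parameter `1`. -/
structure IsExpClock [MeasurableSpace Ω] (μ : Measure Ω) (S : ℕ → Ω → ℝ) : Prop where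
  measurable : ∀ n, Measurable (S n)
  law : ∀ n, μ.map (S n) = expMeasure 1
  indep : iIndepFun S μ

/-- The holding time in the state `Y n`, that is, the `(n+1)`-st holding time; the exponential
variables are indexed from `0`. -/
def holdingTime (lam C₁ C₂ c : ℝ) (Y : ℕ → Ω → Word) (S : ℕ → Ω → ℝ) (n : ℕ) (ω : Ω) : ℝ :=
  S n ω / rate lam C₁ C₂ c (Y n ω)

/-- The `n`-th jumping time: the sum of the first `n` holding times (`J₀ = 0`). -/
def jumpTime (lam C₁ C₂ c : ℝ) (Y : ℕ → Ω → Word) (S : ℕ → Ω → ℝ) (n : ℕ) (ω : Ω) : ℝ :=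
  ∑ i ∈ Finset.range n, holdingTime lam C₁ C₂ c Y S i ω

open Classical in
/-- The process `X_t`: it equals `Y_n` for `J_n ≤ t < J_{n+1}`, and is at the death point `none` if
there is no such `n`. -/
def vsrw (lam C₁ C₂ c : ℝ) (Y : ℕ → Ω → Word) (S : ℕ → Ω → ℝ) (t : ℝ≥0) (ω : Ω) : Option Word :=
  if h : ∃ n, jumpTime lam C₁ C₂ c Y S n ω ≤ t ∧ t < jumpTime lam C₁ C₂ c Y S (n + 1) ω then
    some (Y h.choose ω)
  else none

/-- The lifetime `ζ = ∑ T_n = lim J_n`, with values in `[0, ∞]`. -/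
def lifetime (lam C₁ C₂ c : ℝ) (Y : ℕ → Ω → Word) (S : ℕ → Ω → ℝ) (ω : Ω) : ℝ≥0∞ :=
  ∑' n, ENNReal.ofReal (holdingTime lam C₁ C₂ c Y S n ω)

/-- `|X|` for a state `X`. The death point gets the value `0`, so that `|X_t| → ∞` forces `X_t` to
be alive eventually. -/
def absState : Option Word → ℕ
  | none => 0
  | some w => w.len

end SierpinskiWalk

end

namespace SierpinskiWalk

/-! ### Exponential clocks -/

/-! The proof is a Lyapunov argument with `f x = r ^ |x|`, for any `r` with `lam < r < 1`.
Horizontal edges do not see `f`. On vertical edges the drift `π (f - P f)` equals `k (r / (3 lam)) ^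
|x|` off the root, with `k = 3 (1 - r) (1 - lam / r) > 0`, and is larger at the root. Since `c ≤ r`,
it dominates `k m`, so `P f + k / α ≤ f` (`tsum_transProb_mul_add_le`). Telescoping along the chain
and using `f ≤ 1` bounds the expectation of `∑ 1 / α (Y n)` by `1 / k`. This one bound is used
twice. The clocks have mean `1` and are independent of the chain, so the lifetime has the same
expectation and is almost surely finite (`ae_lifetime_lt_top`). Also `1 / α` is positive at each
state, so a convergent sum allows only finitely many visits to each word, hence `|Y n| → ∞`
(`tendsto_len_of_tsum_inv_rate_ne_top`). No separate proof of transience is needed. The rest is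
deterministic: `tendsto_absState_vsrw` transfers the limit from the chain to the process. -/

/-- Multiplying the exponential density by `t` gives `t e⁻ᵗ`, the Gamma density of shape `2`, whose
total mass is `1`. -/
lemma lintegral_ofReal_expMeasure : ∫⁻ t, ENNReal.ofReal t ∂(expMeasure 1) = 1 := by
  have hm : Measurable (gammaPDF 1 1) := (measurable_gammaPDFReal 1 1).ennreal_ofReal
  rw [expMeasure, gammaMeasure, lintegral_withDensity_eq_lintegral_mul _ hm (by fun_prop),
    ← lintegral_gammaPDF_eq_one (a := 2) (r := 1) two_pos one_pos]
  refine lintegral_congr fun t => ?_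
  rcases lt_or_ge t 0 with ht | ht
  · simp [gammaPDF_of_neg ht]
  · rw [Pi.mul_apply, gammaPDF_of_nonneg ht, gammaPDF_of_nonneg ht,
      ← ENNReal.ofReal_mul (by simp; positivity)]
    congr 1
    have h : (2 : ℝ) - 1 = 1 := by norm_num
    simp [h, mul_comm]

lemma expMeasure_ae_pos : ∀ᵐ t ∂(expMeasure 1), 0 < t := by
  have h0 : expMeasure 1 (Set.Iic 0) = 0 := by
    rw [expMeasure, gammaMeasure, withDensity_apply _ measurableSet_Iic,
      setLIntegral_congr Iio_ae_eq_Iic.symm]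
    exact lintegral_gammaPDF_of_nonpos le_rfl
  rw [ae_iff]
  simpa [Set.Iic, not_lt] using h0

/-! ### Conductances -/

section Conductance

variable {lam C₁ C₂ c : ℝ}

lemma Word.len_father (w : Word) : w.father.len = w.len - 1 := List.length_dropLast

lemma conductance_nonneg (hlam : 0 < lam) (hC₁ : 0 < C₁) (hC₂ : 0 < C₂) (x y : Word) :
    0 ≤ conductance lam C₁ C₂ x y := by
  unfold conductance
  split_ifs <;> positivity

lemma len_le_of_conductance_ne_zero {x y : Word} (h : conductance lam C₁ C₂ x y ≠ 0) :
    y.len ≤ x.len + 1 := by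
  unfold conductance at h
  split_ifs at h with h1 h2
  · rcases h1 with ⟨h, rfl⟩ | ⟨h, rfl⟩ <;> rw [Word.len_father] <;> omega
  · have := h2.1
    omega
  · have := h2.1
    omega
  · exact absurd rfl h

lemma finite_len_le (n : ℕ) : {w : Word | w.len ≤ n}.Finite := List.finite_length_le (Fin 3) n

/-- The words of length at most `n`. -/
noncomputable def wordsUpTo (n : ℕ) : Finset Word := (finite_len_le n).toFinset

lemma mem_wordsUpTo {n : ℕ} {w : Word} : w ∈ wordsUpTo n ↔ w.len ≤ n := by simp [wordsUpTo]

lemma conductance_eq_zero {x y : Word} (h : y ∉ wordsUpTo (x.len + 1)) :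
    conductance lam C₁ C₂ x y = 0 := by
  by_contra h0
  exact h (mem_wordsUpTo.2 (len_le_of_conductance_ne_zero h0))

lemma totalCond_eq_sum (x : Word) :
    totalCond lam C₁ C₂ x = ∑ y ∈ wordsUpTo (x.len + 1), conductance lam C₁ C₂ x y :=
  tsum_eq_sum fun _ h => conductance_eq_zero h

/-- The child `wi` of the word `w`. -/
def Word.child (w : Word) (i : Fin 3) : Word := List.append w [i]

lemma Word.len_child (w : Word) (i : Fin 3) : (w.child i).len = w.len + 1 :=
  List.length_append

lemma Word.father_child (w : Word) (i : Fin 3) : (w.child i).father = w :=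
  List.dropLast_concat

lemma Word.child_injective (w : Word) : Function.Injective w.child := fun i j h => by
  simpa using List.append_cancel_left (as := w) h

lemma Word.exists_eq_child {w : Word} (h : 1 ≤ w.len) : ∃ i, w = w.father.child i := by
  have h0 : w ≠ ([] : List (Fin 3)) := List.ne_nil_of_length_pos h
  exact ⟨List.getLast w h0, (List.dropLast_append_getLast h0).symm⟩

lemma conductance_child (x : Word) (i : Fin 3) :
    conductance lam C₁ C₂ x (x.child i) = 1 / (3 * lam) ^ x.len := by
  have h : VertAdj x (x.child i) :=
    Or.inr ⟨by rw [Word.len_child]; omega, (Word.father_child x i).symm⟩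
  rw [conductance, if_pos h, Word.len_child, min_eq_left (Nat.le_succ _)]

lemma conductance_father {x : Word} (hx : 1 ≤ x.len) :
    conductance lam C₁ C₂ x x.father = 1 / (3 * lam) ^ (x.len - 1) := by
  have h : VertAdj x x.father := Or.inl ⟨hx, rfl⟩
  rw [conductance, if_pos h, Word.len_father, min_eq_right (Nat.sub_le _ _)]

lemma len_eq_of_conductance_ne_zero {x y : Word} (h : conductance lam C₁ C₂ x y ≠ 0)
    (hv : ¬ VertAdj x y) : y.len = x.len := by
  unfold conductance at h
  rw [if_neg hv] at h
  split_ifs at h with h2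
  exacts [h2.1.symm, h2.1.symm, absurd rfl h]

lemma totalCond_pos (hlam : 0 < lam) (hC₁ : 0 < C₁) (hC₂ : 0 < C₂) (x : Word) :
    0 < totalCond lam C₁ C₂ x := by
  rw [totalCond_eq_sum]
  refine Finset.sum_pos' (fun y _ => conductance_nonneg hlam hC₁ hC₂ x y)
    ⟨x.child 0, mem_wordsUpTo.2 (Word.len_child x 0).le, ?_⟩
  rw [conductance_child]
  positivity

lemma weight_pos (hlam : 0 < lam) (hc : 0 < c) (x : Word) : 0 < weight lam c x := by
  unfold weight
  positivity

lemma rate_pos (hlam : 0 < lam) (hC₁ : 0 < C₁) (hC₂ : 0 < C₂) (hc : 0 < c) (x : Word) :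
    0 < rate lam C₁ C₂ c x :=
  div_pos (totalCond_pos hlam hC₁ hC₂ x) (weight_pos hlam hc x)

lemma transProb_nonneg (hlam : 0 < lam) (hC₁ : 0 < C₁) (hC₂ : 0 < C₂) (x y : Word) :
    0 ≤ transProb lam C₁ C₂ x y :=
  div_nonneg (conductance_nonneg hlam hC₁ hC₂ x y) (totalCond_pos hlam hC₁ hC₂ x).le

/-- Horizontal edges do not contribute to the Laplacian of a function of the length. -/
lemma sum_conductance_mul_sub (r : ℝ) (x : Word) :
    ∑ y ∈ wordsUpTo (x.len + 1), conductance lam C₁ C₂ x y * (r ^ x.len - r ^ y.len) =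
      3 * (1 / (3 * lam) ^ x.len * (r ^ x.len - r ^ (x.len + 1))) +
      if 1 ≤ x.len then
        1 / (3 * lam) ^ (x.len - 1) * (r ^ x.len - r ^ (x.len - 1)) else 0 := by
  classical
  set F : Word → ℝ := fun y => conductance lam C₁ C₂ x y * (r ^ x.len - r ^ y.len) with hF
  have hchild : ∑ y ∈ Finset.univ.image x.child, F y =
      3 * (1 / (3 * lam) ^ x.len * (r ^ x.len - r ^ (x.len + 1))) := by
    rw [Finset.sum_image (Word.child_injective x).injOn]
    simp [hF, conductance_child, Word.len_child]
  -- Any neighbour other than a child or the father is horizontal, so it has the same length and the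
  -- difference of powers vanishes.
  have hvert : ∀ y, y ∉ Finset.univ.image x.child → (1 ≤ x.len → y ≠ x.father) → F y = 0 := by
    intro y h1 h2
    by_cases h0 : conductance lam C₁ C₂ x y = 0
    · simp [hF, h0]
    · have hv : ¬ VertAdj x y := by
        rintro (⟨h, h'⟩ | ⟨h, rfl⟩)
        · exact h2 h h'
        · obtain ⟨i, hi⟩ := Word.exists_eq_child h
          exact h1 (Finset.mem_image.2 ⟨i, Finset.mem_univ _, hi.symm⟩)
      simp [hF, len_eq_of_conductance_ne_zero h0 hv]
  have hsub : Finset.univ.image x.child ⊆ wordsUpTo (x.len + 1) := by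
    intro y hy
    obtain ⟨i, -, rfl⟩ := Finset.mem_image.1 hy
    exact mem_wordsUpTo.2 (Word.len_child x i).le
  split_ifs with hx
  · have hnot : x.father ∉ Finset.univ.image x.child := by
      intro h
      obtain ⟨i, -, h⟩ := Finset.mem_image.1 h
      have := congrArg Word.len h
      rw [Word.len_child, Word.len_father] at this
      omega
    have hfather : F x.father = 1 / (3 * lam) ^ (x.len - 1) * (r ^ x.len - r ^ (x.len - 1)) := by
      simp only [hF, conductance_father hx, Word.len_father]
    rw [← hchild, ← hfather, add_comm (∑ y ∈ _, F y), ← Finset.sum_insert hnot]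
    refine (Finset.sum_subset ?_ ?_).symm
    · refine Finset.insert_subset (mem_wordsUpTo.2 ?_) hsub
      rw [Word.len_father]
      omega
    · intro y _ hy
      rw [Finset.mem_insert, not_or] at hy
      exact hvert y hy.2 fun _ => hy.1
  · rw [← hchild, add_zero]
    exact (Finset.sum_subset hsub fun y _ hy => hvert y hy fun h => absurd h hx).symm

/-- After `c` is replaced by `r` in the weight, equality holds off the root: factoring out `(r / (3
lam)) ^ n` leaves `3 (1 - r) - 3 lam (1 / r - 1)`, which is the constant on the left. -/
lemma le_sum_conductance_mul_sub {r : ℝ} (hlam : 0 < lam) (hc : 0 < c) (hr : lam < r)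
    (hr1 : r < 1) (hcr : c ≤ r) (x : Word) :
    3 * (1 - r) * (1 - lam / r) * weight lam c x ≤
      ∑ y ∈ wordsUpTo (x.len + 1), conductance lam C₁ C₂ x y * (r ^ x.len - r ^ y.len) := by
  rw [sum_conductance_mul_sub, weight]
  generalize x.len = n
  have hr0 : 0 < r := hlam.trans hr
  have hdiv : 0 < lam / r := div_pos hlam hr0
  have hdiv1 : lam / r < 1 := (div_lt_one hr0).2 hr
  have hk : 0 ≤ 3 * (1 - r) * (1 - lam / r) :=
    mul_nonneg (by linarith) (by linarith)
  have hle : (c / (3 * lam)) ^ n ≤ (r / (3 * lam)) ^ n := by gcongr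
  refine (mul_le_mul_of_nonneg_left hle hk).trans ?_
  cases n with
  -- The root has no father pulling the sum down: it equals `3 (1 - r)`, and `1 - lam / r ≤ 1`.
  | zero =>
    simp
    nlinarith
  | succ n =>
    simp only [le_add_iff_nonneg_left, zero_le, if_true, Nat.add_sub_cancel]
    apply le_of_eq
    rw [div_pow]
    field_simp
    ring

/-- This is the previous inequality divided by `π(x)`. It is stated additively in `ℝ≥0∞`, which
spares subtraction and integrability conditions when it is integrated along the chain. -/
lemma tsum_transProb_mul_add_le {r : ℝ} (hlam : 0 < lam) (hC₁ : 0 < C₁) (hC₂ : 0 < C₂)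
    (hc : 0 < c) (hr : lam < r) (hr1 : r < 1) (hcr : c ≤ r) (x : Word) :
    ∑' y, ENNReal.ofReal (transProb lam C₁ C₂ x y) * ENNReal.ofReal (r ^ y.len) +
      ENNReal.ofReal (3 * (1 - r) * (1 - lam / r)) * ENNReal.ofReal (1 / rate lam C₁ C₂ c x) ≤
    ENNReal.ofReal (r ^ x.len) := by
  have hr0 : 0 < r := hlam.trans hr
  have hk : 0 ≤ 3 * (1 - r) * (1 - lam / r) :=
    mul_nonneg (by linarith) (sub_nonneg.2 ((div_lt_one hr0).2 hr).le)
  have hpi := totalCond_pos hlam hC₁ hC₂ x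
  have hP := transProb_nonneg hlam hC₁ hC₂ x
  rw [tsum_eq_sum (s := wordsUpTo (x.len + 1))
    (fun y hy => by simp [transProb, conductance_eq_zero hy])]
  simp_rw [← ENNReal.ofReal_mul (hP _)]
  rw [← ENNReal.ofReal_mul hk,
    ← ENNReal.ofReal_sum_of_nonneg (fun y _ => mul_nonneg (hP y) (pow_nonneg hr0.le _)),
    ← ENNReal.ofReal_add (Finset.sum_nonneg fun y _ => mul_nonneg (hP y) (pow_nonneg hr0.le _))
      (mul_nonneg hk (one_div_pos.2 (rate_pos hlam hC₁ hC₂ hc x)).le)]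
  apply ENNReal.ofReal_le_ofReal
  have h := le_sum_conductance_mul_sub (C₁ := C₁) (C₂ := C₂) hlam hc hr hr1 hcr x
  simp_rw [mul_sub, Finset.sum_sub_distrib, ← Finset.sum_mul, ← totalCond_eq_sum] at h
  simp_rw [transProb, rate, div_mul_eq_mul_div, ← Finset.sum_div, one_div_div]
  rw [← mul_div_assoc, ← add_div, div_le_iff₀ hpi]
  simp_rw [mul_sub] at *
  linarith

end Conductance

/-! ### The embedded chain -/

section Chain

variable {lam C₁ C₂ c : ℝ} {x₀ : Word} {Ω : Type*} [MeasurableSpace Ω] {μ : Measure Ω}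
  {Y : ℕ → Ω → Word}

/-- The law of `Y` is given only on cylinders. The one-step Markov property follows by splitting
over the countably many histories up to time `n` that end at `z`. -/
lemma IsWalkFrom.measure_and_succ (hlam : 0 < lam) (hC₁ : 0 < C₁) (hC₂ : 0 < C₂)
    (hY : IsWalkFrom lam C₁ C₂ x₀ μ Y) (n : ℕ) (z y : Word) :
    μ ({ω | Y n ω = z} ∩ {ω | Y (n + 1) ω = y}) =
      μ {ω | Y n ω = z} * ENNReal.ofReal (transProb lam C₁ C₂ z y) := by
  let H : Ω → (Fin (n + 1) → Word) := fun ω i => Y i ω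
  have hH : Measurable H := measurable_pi_lambda _ fun i => hY.measurable i
  let s : Set (Fin (n + 1) → Word) := {h | h (Fin.last n) = z}
  have hs : H ⁻¹' s = {ω | Y n ω = z} := by
    ext ω
    simp [H, s]
  have hy : MeasurableSet {ω | Y (n + 1) ω = y} :=
    hY.measurable (n + 1) (MeasurableSet.singleton y)
  have key : ∀ h ∈ s, μ (H ⁻¹' {h} ∩ {ω | Y (n + 1) ω = y}) =
      μ (H ⁻¹' {h}) * ENNReal.ofReal (transProb lam C₁ C₂ z y) := by
    intro h hz
    -- The history `h` continued by `y`; only its values up to index `n + 1` matter.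
    let w : ℕ → Word := fun i => if hi : i < n + 1 then h ⟨i, hi⟩ else y
    have hwn : w n = z := by
      simp only [w, Nat.lt_succ_self, dite_true]
      exact hz
    have hws : w (n + 1) = y := by simp [w]
    have e1 : H ⁻¹' {h} = {ω | ∀ i ≤ n, Y i ω = w i} := by
      ext ω
      simp only [Set.mem_preimage, Set.mem_singleton_iff, funext_iff, Set.mem_ofPred_eq, H, w]
      constructor
      · intro hi i hin
        rw [dif_pos (Nat.lt_succ_of_le hin)]
        exact hi ⟨i, Nat.lt_succ_of_le hin⟩
      · intro hi i
        have := hi i (Nat.le_of_lt_succ i.2)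
        rwa [dif_pos i.2] at this
    have e2 : H ⁻¹' {h} ∩ {ω | Y (n + 1) ω = y} = {ω | ∀ i ≤ n + 1, Y i ω = w i} := by
      rw [e1]
      ext ω
      simp only [Set.mem_inter_iff, Set.mem_ofPred_eq]
      constructor
      · rintro ⟨h1, h2⟩ i hi
        rcases Nat.le_succ_iff.1 hi with hi | rfl
        · exact h1 i hi
        · rw [h2, hws]
      · exact fun h1 => ⟨fun i hi => h1 i (hi.trans (Nat.le_succ n)),
          (h1 (n + 1) le_rfl).trans hws⟩
    rw [e2, e1, hY.law, hY.law, Finset.prod_range_succ, ← mul_assoc, hwn, hws,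
      ENNReal.ofReal_mul' (transProb_nonneg hlam hC₁ hC₂ z y)]
  have h1 := tsum_measure_preimage_singleton (μ := μ) s.to_countable
    (fun h _ => hH (MeasurableSet.singleton h))
  have h2 := tsum_measure_preimage_singleton (μ := μ.restrict {ω | Y (n + 1) ω = y})
    s.to_countable (fun h _ => hH (MeasurableSet.singleton h))
  rw [hs] at h1 h2
  rw [Measure.restrict_apply' hy] at h2
  rw [← h1, ← h2, ← ENNReal.tsum_mul_right]
  refine tsum_congr fun h => ?_
  rw [Measure.restrict_apply' hy]
  exact key h h.2

lemma IsWalkFrom.measure_succ (hlam : 0 < lam) (hC₁ : 0 < C₁) (hC₂ : 0 < C₂)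
    (hY : IsWalkFrom lam C₁ C₂ x₀ μ Y) (n : ℕ) (y : Word) :
    μ {ω | Y (n + 1) ω = y} =
      ∑' z, μ {ω | Y n ω = z} * ENNReal.ofReal (transProb lam C₁ C₂ z y) := by
  have hy : MeasurableSet {ω | Y (n + 1) ω = y} :=
    hY.measurable (n + 1) (MeasurableSet.singleton y)
  have h := tsum_measure_preimage_singleton (μ := μ.restrict {ω | Y (n + 1) ω = y})
    (Set.univ : Set Word).to_countable
    (fun z _ => hY.measurable n (MeasurableSet.singleton z))
  rw [tsum_univ fun z => (μ.restrict {ω | Y (n + 1) ω = y}) (Y n ⁻¹' {z}), Set.preimage_univ,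
    Measure.restrict_apply_univ] at h
  rw [← h]
  refine tsum_congr fun z => ?_
  rw [Measure.restrict_apply' hy]
  exact hY.measure_and_succ hlam hC₁ hC₂ n z y

lemma IsWalkFrom.lintegral_comp (hY : IsWalkFrom lam C₁ C₂ x₀ μ Y) (n : ℕ) (f : Word → ℝ≥0∞) :
    ∫⁻ ω, f (Y n ω) ∂μ = ∑' z, μ {ω | Y n ω = z} * f z := by
  rw [← lintegral_map (measurable_of_countable f) (hY.measurable n), lintegral_countable']
  refine tsum_congr fun z => ?_
  rw [mul_comm, Measure.map_apply (hY.measurable n) (MeasurableSet.singleton z)]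
  rfl

lemma IsWalkFrom.lintegral_succ (hlam : 0 < lam) (hC₁ : 0 < C₁) (hC₂ : 0 < C₂)
    (hY : IsWalkFrom lam C₁ C₂ x₀ μ Y) (n : ℕ) (f : Word → ℝ≥0∞) :
    ∫⁻ ω, f (Y (n + 1) ω) ∂μ =
      ∫⁻ ω, ∑' y, ENNReal.ofReal (transProb lam C₁ C₂ (Y n ω) y) * f y ∂μ := by
  rw [hY.lintegral_comp (n + 1) f, hY.lintegral_comp n
    (fun z => ∑' y, ENNReal.ofReal (transProb lam C₁ C₂ z y) * f y)]
  simp_rw [hY.measure_succ hlam hC₁ hC₂, ← ENNReal.tsum_mul_right, ← ENNReal.tsum_mul_left]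
  rw [ENNReal.tsum_comm]
  simp_rw [mul_assoc]

/-- A nonnegative function `f` with `P f + g ≤ f` bounds the expected sum of `g` along the
chain. -/
lemma IsWalkFrom.sum_lintegral_le (hlam : 0 < lam) (hC₁ : 0 < C₁) (hC₂ : 0 < C₂)
    (hY : IsWalkFrom lam C₁ C₂ x₀ μ Y) {f g : Word → ℝ≥0∞}
    (hfg : ∀ x, ∑' y, ENNReal.ofReal (transProb lam C₁ C₂ x y) * f y + g x ≤ f x) (n : ℕ) :
    ∫⁻ ω, f (Y n ω) ∂μ + ∑ i ∈ Finset.range n, ∫⁻ ω, g (Y i ω) ∂μ ≤ ∫⁻ ω, f (Y 0 ω) ∂μ := by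
  induction n with
  | zero => simp
  | succ n ih =>
    refine le_trans ?_ ih
    -- Regrouping isolates the integrals of `f (Y (n + 1))` and `g (Y n)`, which together are at
    -- most that of `f (Y n)`.
    rw [Finset.sum_range_succ, add_comm (∑ i ∈ Finset.range n, _), ← add_assoc]
    gcongr
    have hg : Measurable fun ω => g (Y n ω) :=
      (measurable_of_countable g).comp (hY.measurable n)
    rw [hY.lintegral_succ hlam hC₁ hC₂, ← lintegral_add_right _ hg]
    exact lintegral_mono fun ω => hfg (Y n ω)

lemma IsWalkFrom.tsum_lintegral_inv_rate_ne_top [IsProbabilityMeasure μ] (hlam0 : 0 < lam)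
    (hlam1 : lam < 1) (hC₁ : 0 < C₁) (hC₂ : 0 < C₂) (hc0 : 0 < c) (hc1 : c < lam)
    (hY : IsWalkFrom lam C₁ C₂ x₀ μ Y) :
    ∑' n, ∫⁻ ω, ENNReal.ofReal (1 / rate lam C₁ C₂ c (Y n ω)) ∂μ ≠ ⊤ := by
  obtain ⟨r, hr, hr1⟩ := exists_between hlam1
  have hr0 : 0 < r := hlam0.trans hr
  set k : ℝ := 3 * (1 - r) * (1 - lam / r) with hk
  have hk0 : 0 < k :=
    mul_pos (by linarith) (sub_pos.2 ((div_lt_one hr0).2 hr))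
  have hbound : ENNReal.ofReal k *
      ∑' n, ∫⁻ ω, ENNReal.ofReal (1 / rate lam C₁ C₂ c (Y n ω)) ∂μ ≤ 1 := by
    rw [← ENNReal.tsum_mul_left]
    refine ENNReal.tsum_le_of_sum_range_le fun n => ?_
    have h := hY.sum_lintegral_le hlam0 hC₁ hC₂
      (f := fun x => ENNReal.ofReal (r ^ x.len))
      (g := fun x => ENNReal.ofReal k * ENNReal.ofReal (1 / rate lam C₁ C₂ c x))
      (fun x => tsum_transProb_mul_add_le hlam0 hC₁ hC₂ hc0 hr hr1 (hc1.trans hr).le x) n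
    simp_rw [lintegral_const_mul' _ _ ENNReal.ofReal_ne_top] at h
    -- The term with `f (Y n)` is dropped, and `f ≤ 1` bounds the starting value.
    refine (le_add_self.trans h).trans ?_
    calc ∫⁻ ω, ENNReal.ofReal (r ^ (Y 0 ω).len) ∂μ ≤ ∫⁻ _, 1 ∂μ :=
          lintegral_mono fun ω => by
            simpa using pow_le_one₀ hr0.le hr1.le
      _ = 1 := by simp
  intro htop
  rw [htop, ENNReal.mul_top (by simpa using hk0)] at hbound
  exact absurd hbound (by simp)

lemma IsWalkFrom.ae_tsum_inv_rate_ne_top [IsProbabilityMeasure μ] (hlam0 : 0 < lam)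
    (hlam1 : lam < 1) (hC₁ : 0 < C₁) (hC₂ : 0 < C₂) (hc0 : 0 < c) (hc1 : c < lam)
    (hY : IsWalkFrom lam C₁ C₂ x₀ μ Y) :
    ∀ᵐ ω ∂μ, ∑' n, ENNReal.ofReal (1 / rate lam C₁ C₂ c (Y n ω)) ≠ ⊤ := by
  have hm : ∀ n, Measurable fun ω => ENNReal.ofReal (1 / rate lam C₁ C₂ c (Y n ω)) := fun n =>
    (measurable_of_countable fun x => ENNReal.ofReal (1 / rate lam C₁ C₂ c x)).comp
      (hY.measurable n)
  have h := hY.tsum_lintegral_inv_rate_ne_top hlam0 hlam1 hC₁ hC₂ hc0 hc1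
  rw [← lintegral_tsum fun n => (hm n).aemeasurable] at h
  filter_upwards [ae_lt_top (.tsum hm) h] with ω hω using hω.ne

/-- A path along which the mean holding times are summable leaves every finite set. -/
lemma tendsto_len_of_tsum_inv_rate_ne_top (hlam : 0 < lam) (hC₁ : 0 < C₁) (hC₂ : 0 < C₂)
    (hc : 0 < c) {y : ℕ → Word}
    (h : ∑' n, ENNReal.ofReal (1 / rate lam C₁ C₂ c (y n)) ≠ ⊤) :
    Tendsto (fun n => (y n).len) atTop atTop := by
  have h0 := ENNReal.tendsto_atTop_zero_of_tsum_ne_top h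
  -- Each visit to `z` contributes the same positive term, while the terms of a convergent series
  -- tend to `0`.
  have hne : ∀ z, ∀ᶠ n in atTop, y n ≠ z := by
    intro z
    have hz : 0 < ENNReal.ofReal (1 / rate lam C₁ C₂ c z) :=
      ENNReal.ofReal_pos.2 (one_div_pos.2 (rate_pos hlam hC₁ hC₂ hc z))
    filter_upwards [h0.eventually_lt_const hz] with n hn hyz
    rw [hyz] at hn
    exact lt_irrefl _ hn
  refine tendsto_atTop.2 fun N => ?_
  have hall := (Finset.eventually_all (wordsUpTo N)).2 fun z _ => hne z
  filter_upwards [hall] with n hn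
  by_contra hlt
  exact hn (y n) (mem_wordsUpTo.2 (not_le.1 hlt).le) rfl

end Chain

/-! ### The lifetime -/

section Lifetime

variable {lam C₁ C₂ c : ℝ} {x₀ : Word} {Ω : Type*} [MeasurableSpace Ω] {μ : Measure Ω}
  {Y : ℕ → Ω → Word} {S : ℕ → Ω → ℝ}

lemma IsExpClock.ae_pos (hS : IsExpClock μ S) : ∀ᵐ ω ∂μ, ∀ n, 0 < S n ω := by
  refine ae_all_iff.2 fun n => ?_
  have h := expMeasure_ae_pos
  rw [← hS.law n] at h
  exact ae_of_ae_map (hS.measurable n).aemeasurable h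

lemma IsExpClock.lintegral_eq_one (hS : IsExpClock μ S) (n : ℕ) :
    ∫⁻ ω, ENNReal.ofReal (S n ω) ∂μ = 1 := by
  rw [← lintegral_map (f := fun t => ENNReal.ofReal t) (by fun_prop) (hS.measurable n), hS.law n,
    lintegral_ofReal_expMeasure]

/-- By independence each holding time has mean `E[1 / α (Y n)] · E[S n]`, and the second factor is
`1`. -/
lemma ae_lifetime_lt_top [IsProbabilityMeasure μ] (hlam0 : 0 < lam)
    (hlam1 : lam < 1) (hC₁ : 0 < C₁) (hC₂ : 0 < C₂) (hc0 : 0 < c) (hc1 : c < lam)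
    (hY : IsWalkFrom lam C₁ C₂ x₀ μ Y) (hS : IsExpClock μ S)
    (hYS : IndepFun (fun ω n => Y n ω) (fun ω n => S n ω) μ) :
    ∀ᵐ ω ∂μ, lifetime lam C₁ C₂ c Y S ω < ⊤ := by
  have hmY : ∀ n, Measurable fun ω => ENNReal.ofReal (1 / rate lam C₁ C₂ c (Y n ω)) := fun n =>
    (measurable_of_countable fun x => ENNReal.ofReal (1 / rate lam C₁ C₂ c x)).comp
      (hY.measurable n)
  have hmS : ∀ n, Measurable fun ω => ENNReal.ofReal (S n ω) := fun n =>
    (hS.measurable n).ennreal_ofReal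
  have hT : ∀ n ω, ENNReal.ofReal (holdingTime lam C₁ C₂ c Y S n ω) =
      ENNReal.ofReal (1 / rate lam C₁ C₂ c (Y n ω)) * ENNReal.ofReal (S n ω) := fun n ω => by
    rw [holdingTime, ← ENNReal.ofReal_mul (one_div_pos.2 (rate_pos hlam0 hC₁ hC₂ hc0 _)).le,
      one_div_mul_eq_div]
  have hmT : ∀ n, Measurable fun ω => ENNReal.ofReal (holdingTime lam C₁ C₂ c Y S n ω) :=
    fun n => by
      simp_rw [hT]
      exact (hmY n).mul (hmS n)
  have hmean : ∀ n, ∫⁻ ω, ENNReal.ofReal (holdingTime lam C₁ C₂ c Y S n ω) ∂μ =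
      ∫⁻ ω, ENNReal.ofReal (1 / rate lam C₁ C₂ c (Y n ω)) ∂μ := fun n => by
    have hind : IndepFun (fun ω => ENNReal.ofReal (1 / rate lam C₁ C₂ c (Y n ω)))
        (fun ω => ENNReal.ofReal (S n ω)) μ :=
      hYS.comp (φ := fun y : ℕ → Word => ENNReal.ofReal (1 / rate lam C₁ C₂ c (y n)))
        (ψ := fun s : ℕ → ℝ => ENNReal.ofReal (s n))
        ((measurable_of_countable fun x => ENNReal.ofReal (1 / rate lam C₁ C₂ c x)).comp
          (measurable_pi_apply n))
        (measurable_pi_apply n).ennreal_ofReal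
    simp_rw [hT]
    have := lintegral_mul_eq_lintegral_mul_lintegral_of_indepFun (hmY n) (hmS n) hind
    simpa [hS.lintegral_eq_one n] using this
  refine ae_lt_top (.tsum hmT) ?_
  simp_rw [lifetime]
  rw [lintegral_tsum fun n => (hmT n).aemeasurable]
  simp_rw [hmean]
  exact hY.tsum_lintegral_inv_rate_ne_top hlam0 hlam1 hC₁ hC₂ hc0 hc1

end Lifetime

/-! ### Explosion of a single path -/

section Path

variable {lam C₁ C₂ c : ℝ} {Ω : Type*} {Y : ℕ → Ω → Word} {S : ℕ → Ω → ℝ} {ω : Ω}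

/-- Near the end of a finite lifetime the process follows the tail of the embedded chain. -/
lemma tendsto_absState_vsrw (hT : ∀ n, 0 < holdingTime lam C₁ C₂ c Y S n ω)
    (hlen : Tendsto (fun n => (Y n ω).len) atTop atTop)
    (hfin : lifetime lam C₁ C₂ c Y S ω < ⊤) :
    Tendsto (fun t : ℝ≥0 => absState (vsrw lam C₁ C₂ c Y S t ω))
      (𝓝[<] (lifetime lam C₁ C₂ c Y S ω).toNNReal) atTop := by
  set T : ℕ → ℝ := fun n => holdingTime lam C₁ C₂ c Y S n ω with hTdef
  set J : ℕ → ℝ := fun n => jumpTime lam C₁ C₂ c Y S n ω with hJdef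
  have hJsucc : ∀ n, J (n + 1) = J n + T n := fun n => Finset.sum_range_succ _ _
  have hJ : StrictMono J := strictMono_nat_of_lt_succ fun n => by
    rw [hJsucc]
    exact lt_add_of_pos_right _ (hT n)
  have hJ0 : J 0 = 0 := Finset.sum_range_zero _
  -- `toNNReal` would send `⊤` to `0`; finiteness of the lifetime makes this its true value.
  set ζ : ℝ≥0 := (lifetime lam C₁ C₂ c Y S ω).toNNReal with hζ
  have hsum : HasSum T ζ := by
    have h : Summable T := by
      have := ENNReal.summable_toReal hfin.ne
      refine this.congr fun n => ENNReal.toReal_ofReal (hT n).le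
    have e : (ζ : ℝ) = ∑' n, T n := by
      rw [hζ, ENNReal.coe_toNNReal_eq_toReal, lifetime,
        ENNReal.tsum_toReal_eq fun _ => ENNReal.ofReal_ne_top]
      exact tsum_congr fun n => ENNReal.toReal_ofReal (hT n).le
    rw [e]
    exact h.hasSum
  have hlim : Tendsto J atTop (𝓝 ζ) := hsum.tendsto_sum_nat
  have hJlt : ∀ n, J n < ζ := fun n =>
    (hJ (Nat.lt_succ_self n)).trans_le (hJ.monotone.ge_of_tendsto hlim (n + 1))
  refine tendsto_atTop.2 fun N => ?_
  obtain ⟨n₀, hn₀⟩ := eventually_atTop.1 (tendsto_atTop.1 hlen N)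
  have hJn : 0 ≤ J n₀ := hJ0 ▸ hJ.monotone (Nat.zero_le n₀)
  have hmem : Set.Ico (⟨J n₀, hJn⟩ : ℝ≥0) ζ ∈ 𝓝[<] ζ :=
    Ico_mem_nhdsLT (hJlt n₀)
  filter_upwards [hmem] with t ht
  have ht1 : J n₀ ≤ t := ht.1
  have ht2 : (t : ℝ) < ζ := ht.2
  -- The process is alive at `t`: take the first jump time beyond `t`. Its index is not `0` because
  -- `J 0 = 0 ≤ t`, so its predecessor is the required `n`.
  have hex : ∃ n, J n ≤ t ∧ (t : ℝ) < J (n + 1) := by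
    have hgt : ∃ n, (t : ℝ) < J n := (hlim.eventually_const_lt ht2).exists
    classical
    have hpos : Nat.find hgt ≠ 0 := fun h0 => by
      have := Nat.find_spec hgt
      rw [h0, hJ0] at this
      exact absurd t.2 (not_le.2 this)
    obtain ⟨m, hm⟩ := Nat.exists_eq_succ_of_ne_zero hpos
    refine ⟨m, not_lt.1 (Nat.find_min hgt (by omega)), ?_⟩
    have := Nat.find_spec hgt
    rwa [hm] at this
  rw [vsrw, dif_pos hex]
  -- Whichever index `choose` returns, `J n₀ ≤ t < J (n + 1)` forces `n₀ ≤ n`, so uniqueness of the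
  -- index is not needed.
  refine hn₀ _ (Nat.le_of_lt_succ (hJ.lt_iff_lt.1 (ht1.trans_lt hex.choose_spec.2)))

end Path

end SierpinskiWalk

theorem mainTheorem10
    (lam C₁ C₂ c : ℝ) (hlam0 : 0 < lam) (hlam1 : lam < 1) (hC₁ : 0 < C₁) (hC₂ : 0 < C₂)
    (hc0 : 0 < c) (hc1 : c < lam)
    (x : SierpinskiWalk.Word)
    {Ω : Type*} [MeasurableSpace Ω] (μ : Measure Ω) [IsProbabilityMeasure μ]
    (Y : ℕ → Ω → SierpinskiWalk.Word) (S : ℕ → Ω → ℝ)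
    (hY : SierpinskiWalk.IsWalkFrom lam C₁ C₂ x μ Y)
    (hS : SierpinskiWalk.IsExpClock μ S)
    (hYS : IndepFun (fun ω n => Y n ω) (fun ω n => S n ω) μ) :
    ∀ᵐ ω ∂μ,
      Tendsto (fun t : ℝ≥0 => SierpinskiWalk.absState (SierpinskiWalk.vsrw lam C₁ C₂ c Y S t ω))
        (𝓝[<] (SierpinskiWalk.lifetime lam C₁ C₂ c Y S ω).toNNReal) atTop ∧
      SierpinskiWalk.lifetime lam C₁ C₂ c Y S ω < ⊤ := by
  open SierpinskiWalk in
  filter_upwards [hS.ae_pos, hY.ae_tsum_inv_rate_ne_top hlam0 hlam1 hC₁ hC₂ hc0 hc1,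
    ae_lifetime_lt_top hlam0 hlam1 hC₁ hC₂ hc0 hc1 hY hS hYS] with ω hpos hrate hfin
  exact ⟨tendsto_absState_vsrw
    (fun n => div_pos (hpos n) (rate_pos hlam0 hC₁ hC₂ hc0 _))
    (tendsto_len_of_tsum_inv_rate_ne_top hlam0 hC₁ hC₂ hc0 hrate) hfin, hfin⟩
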